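/- Let $X_1, X_2, \dots$ be a strictly stationary sequence of real random variables on a probability space, with mean zero and finite variance. Suppose the sequence is associated: for every finite set of indices $i_1<\dots<i_k$ and all coordinatewise non-decreasing Borel functions $h,g:\mathbb{R}^k\to\mathbb{R}$ such that $h(X_{i_1},\dots,X_{i_k})$, $g(X_{i_1},\dots,X_{i_k})$ and their product are integrable, $$\operatorname{Cov}\bigl(h(X_{i_1},\dots,X_{i_k}),\,g(X_{i_1},\dots,X_{i_k})\bigr)\ge 0 .$$ Suppose that the series $\sum_{j\ge 2}\operatorname{Cov}(X_1,X_j)$ converges, and put $$\sigma^2=\operatorname{Var}(X_1)+2\sum_{j=2}^{\infty}\operatorname{Cov}(X_1,X_j)<\infty .$$ Then $\sigma^2\ge 0$ and, with $S_n=X_1+\dots+X_n$, the sequence $S_n/\sqrt n$ converges in distribution to $N(0,\sigma^2)$ as $n\to\infty$, where $N(0,0)$ denotes the point mass at $0$. -/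

import Mathlib

open MeasureTheory ProbabilityTheory Filter Finset

/-- A finite family `X` of real random variables is associated if
`Cov (h (X), g (X)) ≥ 0` for all coordinatewise nondecreasing Borel functions `h, g`
for which this covariance exists, that is, `h (X)`, `g (X)` and `h (X) g (X)` are integrable. -/
def IsAssociatedFinite {Ω ι : Type*} [MeasurableSpace Ω] [Fintype ι]
    (X : ι → Ω → ℝ) (μ : Measure Ω) : Prop :=
  ∀ h g : (ι → ℝ) → ℝ, Measurable h → Measurable g → Monotone h → Monotone g →
    Integrable (fun ω => h (fun i => X i ω)) μ →
    Integrable (fun ω => g (fun i => X i ω)) μ →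
    Integrable (fun ω => h (fun i => X i ω) * g (fun i => X i ω)) μ →
    0 ≤ cov[fun ω => h (fun i => X i ω), fun ω => g (fun i => X i ω); μ]

/-- A sequence of real random variables is associated if all its finite subfamilies are. -/
def IsAssociatedSeq {Ω : Type*} [MeasurableSpace Ω] (X : ℕ → Ω → ℝ) (μ : Measure Ω) : Prop :=
  ∀ s : Finset ℕ, IsAssociatedFinite (fun i : s => X i) μ

/-- Strict stationarity: all finite-dimensional distributions are invariant under time shifts. -/
def IsStrictlyStationary {Ω : Type*} [MeasurableSpace Ω] (X : ℕ → Ω → ℝ) (μ : Measure Ω) : Prop :=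
  ∀ (m : ℕ) (k : Fin m → ℕ) (t : ℕ),
    IdentDistrib (fun ω (i : Fin m) => X (k i + t) ω) (fun ω (i : Fin m) => X (k i) ω) μ μ

/-- `σ² = Var (X₁) + 2 ∑_{j ≥ 2} Cov (X₁, X_j)`. The sequence is indexed from `0` here, so that
`X 0` is `X₁` and `X (j + 1)`, for `j : ℕ`, runs through `X₂, X₃, …`. -/
noncomputable def limitVariance {Ω : Type*} [MeasurableSpace Ω]
    (X : ℕ → Ω → ℝ) (μ : Measure Ω) : ℝ :=
  Var[X 0; μ] + 2 * ∑' j : ℕ, cov[X 0, X (j + 1); μ]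

/-! This is Newman's argument. For associated variables, covariance alone bounds dependence: the
characteristic function of a sum of two partial sums differs from the product of theirs by at most
`4 * t ^ 2` times their covariance. Let `V l` be the variance of a block of length `l`. Cutting `n`
terms into `m = n / l` blocks replaces the characteristic function of the sum by the `m`-th power of
that of one block, with error at most `2 * t ^ 2 * (V (m * l) - m * V l)`. At `t / √n` with `l`
fixed, this error tends to `2 * t ^ 2 * (σ² - V l / l)`, and the power tends to `exp (-(V l / l) * t
^ 2 / 2)`, as for independent blocks. Since `V l / l → σ²`, letting `l → ∞` removes both
discrepancies, and Lévy's continuity theorem concludes. -/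

/-! ### Covariance bounds from association -/

/-- In an associated family, the covariance of two functions is dominated by that of any
monotone functions that dominate their increments. -/
theorem IsAssociatedFinite.abs_covariance_le {Ω ι : Type*} [MeasurableSpace Ω] [Fintype ι]
    {X : ι → Ω → ℝ} {μ : Measure Ω} [IsProbabilityMeasure μ] (hX : IsAssociatedFinite X μ)
    {f g F G : (ι → ℝ) → ℝ} (hf : Measurable f) (hg : Measurable g) (hF : Measurable F)
    (hG : Measurable G) (hfF : Monotone (F + f)) (hfF' : Monotone (F - f))
    (hgG : Monotone (G + g)) (hgG' : Monotone (G - g))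
    (mf : MemLp (fun ω => f (fun i => X i ω)) 2 μ) (mg : MemLp (fun ω => g (fun i => X i ω)) 2 μ)
    (mF : MemLp (fun ω => F (fun i => X i ω)) 2 μ) (mG : MemLp (fun ω => G (fun i => X i ω)) 2 μ) :
    |cov[fun ω => f (fun i => X i ω), fun ω => g (fun i => X i ω); μ]| ≤
      cov[fun ω => F (fun i => X i ω), fun ω => G (fun i => X i ω); μ] := by
  have key : ∀ h k : (ι → ℝ) → ℝ, Measurable h → Measurable k → Monotone h → Monotone k →
      MemLp (fun ω => h (fun i => X i ω)) 2 μ → MemLp (fun ω => k (fun i => X i ω)) 2 μ →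
      0 ≤ cov[fun ω => h (fun i => X i ω), fun ω => k (fun i => X i ω); μ] :=
    fun h k h1 h2 h3 h4 h5 h6 => hX h k h1 h2 h3 h4 (h5.integrable one_le_two)
      (h6.integrable one_le_two) (h5.integrable_mul h6)
  set f' := fun ω => f (fun i => X i ω)
  set g' := fun ω => g (fun i => X i ω)
  set F' := fun ω => F (fun i => X i ω)
  set G' := fun ω => G (fun i => X i ω)
  -- After bilinear expansion the mixed terms cancel in `h1 + h2` and in `h3 + h4`, leaving `Cov(F,
  -- G) ± Cov(f, g) ≥ 0`.
  have h1 : 0 ≤ cov[F' + f', G' + g'; μ] :=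
    key _ _ (hF.add hf) (hG.add hg) hfF hgG (mF.add mf) (mG.add mg)
  have h2 : 0 ≤ cov[F' - f', G' - g'; μ] :=
    key _ _ (hF.sub hf) (hG.sub hg) hfF' hgG' (mF.sub mf) (mG.sub mg)
  have h3 : 0 ≤ cov[F' + f', G' - g'; μ] :=
    key _ _ (hF.add hf) (hG.sub hg) hfF hgG' (mF.add mf) (mG.sub mg)
  have h4 : 0 ≤ cov[F' - f', G' + g'; μ] :=
    key _ _ (hF.sub hf) (hG.add hg) hfF' hgG (mF.sub mf) (mG.add mg)
  rw [covariance_add_left mF mf (mG.add mg), covariance_add_right mF mG mg,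
    covariance_add_right mf mG mg] at h1
  rw [covariance_sub_sub mF mf mG mg] at h2
  rw [covariance_add_left mF mf (mG.sub mg), covariance_sub_right mF mG mg,
    covariance_sub_right mf mG mg] at h3
  rw [covariance_sub_left mF mf (mG.add mg), covariance_add_right mF mG mg,
    covariance_add_right mf mG mg] at h4
  rw [abs_le]
  constructor <;> linarith

/-- Covariances of bounded Lipschitz functions of partial sums of an associated sequence. -/
theorem IsAssociatedSeq.abs_covariance_comp_sum_le {Ω : Type*} [MeasurableSpace Ω]
    {X : ℕ → Ω → ℝ} {μ : Measure Ω} [IsProbabilityMeasure μ] (hX : IsAssociatedSeq X μ)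
    (hL2 : ∀ i, MemLp (X i) 2 μ) (A B : Finset ℕ) {f g : ℝ → ℝ} {K : NNReal} {C : ℝ}
    (hf : LipschitzWith K f) (hg : LipschitzWith K g) (hfC : ∀ x, ‖f x‖ ≤ C)
    (hgC : ∀ x, ‖g x‖ ≤ C) :
    |cov[fun ω => f (∑ i ∈ A, X i ω), fun ω => g (∑ i ∈ B, X i ω); μ]| ≤
      (K : ℝ) ^ 2 * cov[fun ω => ∑ i ∈ A, X i ω, fun ω => ∑ i ∈ B, X i ω; μ] := by
  classical
  have hsum : ∀ D ⊆ A ∪ B, ∀ x : ℕ → ℝ,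
      ∑ i : ↥(A ∪ B), (if (i : ℕ) ∈ D then x i else 0) = ∑ i ∈ D, x i := by
    intro D hD x
    rw [Finset.sum_coe_sort (A ∪ B) (fun i => if i ∈ D then x i else 0), ← Finset.sum_filter,
      Finset.filter_mem_eq_inter, Finset.inter_eq_right.2 hD]
  -- Both sums must be functions of one finite family, so each is extended by zero to `A ∪ B`.
  let T : Finset ℕ → (↥(A ∪ B) → ℝ) → ℝ := fun D x => ∑ i : ↥(A ∪ B), if (i : ℕ) ∈ D then x i else 0
  have hT : ∀ D, Measurable (T D) := fun D => Finset.measurable_sum _ fun i _ => by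
    split_ifs <;> fun_prop
  have hTm : ∀ D, Monotone (T D) := fun D x y hxy => Finset.sum_le_sum fun i _ => by
    split_ifs
    exacts [hxy i, le_rfl]
  have hmono : ∀ D (u : ℝ → ℝ), LipschitzWith K u →
      Monotone ((fun x => (K : ℝ) * T D x) + fun x => u (T D x)) ∧
      Monotone ((fun x => (K : ℝ) * T D x) - fun x => u (T D x)) := by
    intro D u hu
    have hb : ∀ x y, x ≤ y → |u (T D y) - u (T D x)| ≤ K * (T D y - T D x) := fun x y hxy => by
      have := hu.dist_le_mul (T D y) (T D x)
      rwa [Real.dist_eq, Real.dist_eq, abs_of_nonneg (sub_nonneg.2 (hTm D hxy))] at this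
    constructor <;> intro x y hxy <;> have := abs_le.1 (hb x y hxy) <;>
      simp only [Pi.add_apply, Pi.sub_apply] <;> linarith
  have hTA : ∀ ω, T A (fun i => X i ω) = ∑ i ∈ A, X i ω :=
    fun ω => hsum A subset_union_left fun i => X i ω
  have hTB : ∀ ω, T B (fun i => X i ω) = ∑ i ∈ B, X i ω :=
    fun ω => hsum B subset_union_right fun i => X i ω
  have hm : ∀ D : Finset ℕ, MemLp (fun ω => ∑ i ∈ D, X i ω) 2 μ :=
    fun D => memLp_finsetSum D fun i _ => hL2 i
  have hb : ∀ (u : ℝ → ℝ), LipschitzWith K u → (∀ x, ‖u x‖ ≤ C) → ∀ D : Finset ℕ,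
      MemLp (fun ω => u (∑ i ∈ D, X i ω)) 2 μ := fun u hu huC D =>
    MemLp.of_bound (hu.continuous.comp_aestronglyMeasurable (hm D).1) C (ae_of_all _ fun _ => huC _)
  have := (hX (A ∪ B)).abs_covariance_le (f := fun x => f (T A x)) (g := fun x => g (T B x))
    (F := fun x => K * T A x) (G := fun x => K * T B x) (hf.continuous.measurable.comp (hT A))
    (hg.continuous.measurable.comp (hT B)) ((hT A).const_mul _) ((hT B).const_mul _)
    (hmono A f hf).1 (hmono A f hf).2 (hmono B g hg).1 (hmono B g hg).2
    (by simpa only [hTA] using hb f hf hfC A) (by simpa only [hTB] using hb g hg hgC B)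
    (by simpa only [hTA] using (hm A).const_mul _) (by simpa only [hTB] using (hm B).const_mul _)
  simp only [hTA, hTB] at this
  rw [covariance_const_mul_left, covariance_const_mul_right] at this
  linarith [this]

/-! ### Factorization defect of characteristic functions -/

theorem charFun_map_eq_integral_cos_add_integral_sin {Ω : Type*} [MeasurableSpace Ω]
    {μ : Measure Ω} [IsProbabilityMeasure μ] {U : Ω → ℝ} (hU : AEMeasurable U μ) (t : ℝ) :
    charFun (μ.map U) t =
      ((∫ ω, Real.cos (t * U ω) ∂μ : ℝ) : ℂ) + (∫ ω, Real.sin (t * U ω) ∂μ : ℝ) * Complex.I := by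
  have hc : Integrable (fun ω => Real.cos (t * U ω)) μ :=
    Integrable.of_bound (by fun_prop) 1 (ae_of_all _ fun _ => Real.abs_cos_le_one _)
  have hs : Integrable (fun ω => Real.sin (t * U ω)) μ :=
    Integrable.of_bound (by fun_prop) 1 (ae_of_all _ fun _ => Real.abs_sin_le_one _)
  rw [charFun_apply_real, integral_map hU (by fun_prop), ← integral_complex_ofReal, ← integral_complex_ofReal,
    ← integral_mul_const, ← integral_add hc.ofReal (hs.ofReal.mul_const _)]
  refine integral_congr_ae (ae_of_all _ fun ω => ?_)
  simp [Complex.exp_mul_I]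

/-- The addition formulas reduce the complex defect to real covariances of Lipschitz functions,
where association applies. -/
theorem charFun_map_add_sub_mul {Ω : Type*} [MeasurableSpace Ω]
    {μ : Measure Ω} [IsProbabilityMeasure μ] {U V : Ω → ℝ} (hU : AEMeasurable U μ)
    (hV : AEMeasurable V μ) (t : ℝ) :
    charFun (μ.map fun ω => U ω + V ω) t - charFun (μ.map U) t * charFun (μ.map V) t =
      ((cov[fun ω => Real.cos (t * U ω), fun ω => Real.cos (t * V ω); μ]
        - cov[fun ω => Real.sin (t * U ω), fun ω => Real.sin (t * V ω); μ] : ℝ) : ℂ)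
      + ((cov[fun ω => Real.sin (t * U ω), fun ω => Real.cos (t * V ω); μ]
        + cov[fun ω => Real.cos (t * U ω), fun ω => Real.sin (t * V ω); μ] : ℝ) : ℂ)
        * Complex.I := by
  have hc : ∀ W : Ω → ℝ, AEMeasurable W μ → MemLp (fun ω => Real.cos (t * W ω)) 2 μ := fun W hW =>
    MemLp.of_bound (by fun_prop) 1 (ae_of_all _ fun _ => Real.abs_cos_le_one _)
  have hs : ∀ W : Ω → ℝ, AEMeasurable W μ → MemLp (fun ω => Real.sin (t * W ω)) 2 μ := fun W hW =>
    MemLp.of_bound (by fun_prop) 1 (ae_of_all _ fun _ => Real.abs_sin_le_one _)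
  rw [charFun_map_eq_integral_cos_add_integral_sin (U := fun ω => U ω + V ω) (hU.add hV),
    charFun_map_eq_integral_cos_add_integral_sin hU,
    charFun_map_eq_integral_cos_add_integral_sin hV,
    covariance_eq_sub (hc U hU) (hc V hV), covariance_eq_sub (hs U hU) (hs V hV),
    covariance_eq_sub (hs U hU) (hc V hV), covariance_eq_sub (hc U hU) (hs V hV)]
  have hcos := integral_sub ((hc U hU).integrable_mul (hc V hV))
    ((hs U hU).integrable_mul (hs V hV))
  have hsin := integral_add ((hs U hU).integrable_mul (hc V hV))
    ((hc U hU).integrable_mul (hs V hV))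
  simp only [mul_add, Real.cos_add, Real.sin_add, Pi.mul_apply] at hcos hsin ⊢
  rw [hcos, hsin]
  push_cast
  linear_combination (-(∫ ω, Real.sin (t * U ω) ∂μ : ℝ) * (∫ ω, Real.sin (t * V ω) ∂μ : ℝ) : ℂ)
    * Complex.I_sq

/-- Newman's inequality for the characteristic functions of two partial sums. -/
theorem IsAssociatedSeq.norm_charFun_add_sub_mul_le {Ω : Type*} [MeasurableSpace Ω]
    {X : ℕ → Ω → ℝ} {μ : Measure Ω} [IsProbabilityMeasure μ] (hX : IsAssociatedSeq X μ)
    (hL2 : ∀ i, MemLp (X i) 2 μ) (A B : Finset ℕ) (t : ℝ) :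
    ‖charFun (μ.map fun ω => ∑ i ∈ A, X i ω + ∑ i ∈ B, X i ω) t -
      charFun (μ.map fun ω => ∑ i ∈ A, X i ω) t * charFun (μ.map fun ω => ∑ i ∈ B, X i ω) t‖ ≤
      4 * t ^ 2 * cov[fun ω => ∑ i ∈ A, X i ω, fun ω => ∑ i ∈ B, X i ω; μ] := by
  have hm : ∀ D : Finset ℕ, AEMeasurable (fun ω => ∑ i ∈ D, X i ω) μ :=
    fun D => (memLp_finsetSum D fun i _ => hL2 i).1.aemeasurable
  have hl : LipschitzWith ‖t‖₊ (fun x : ℝ => t * x) := LipschitzWith.of_dist_le_mul fun x y => by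
    rw [Real.dist_eq, Real.dist_eq, ← mul_sub, abs_mul]; simp
  have hc : LipschitzWith ‖t‖₊ (fun x => Real.cos (t * x)) := by
    simpa [Function.comp_def] using Real.lipschitzWith_cos.comp hl
  have hs : LipschitzWith ‖t‖₊ (fun x => Real.sin (t * x)) := by
    simpa [Function.comp_def] using Real.lipschitzWith_sin.comp hl
  have bc : ∀ x, ‖Real.cos (t * x)‖ ≤ 1 := fun x => Real.abs_cos_le_one _
  have bs : ∀ x, ‖Real.sin (t * x)‖ ≤ 1 := fun x => Real.abs_sin_le_one _
  have h1 := hX.abs_covariance_comp_sum_le hL2 A B hc hc bc bc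
  have h2 := hX.abs_covariance_comp_sum_le hL2 A B hs hs bs bs
  have h3 := hX.abs_covariance_comp_sum_le hL2 A B hs hc bs bc
  have h4 := hX.abs_covariance_comp_sum_le hL2 A B hc hs bc bs
  simp only [coe_nnnorm, Real.norm_eq_abs, sq_abs] at h1 h2 h3 h4
  rw [charFun_map_add_sub_mul (hm A) (hm B)]
  refine (norm_add_le _ _).trans ?_
  rw [norm_mul, Complex.norm_I, mul_one, Complex.norm_real, Complex.norm_real, Real.norm_eq_abs,
    Real.norm_eq_abs]
  linarith [abs_sub (cov[fun ω => Real.cos (t * ∑ i ∈ A, X i ω), fun ω =>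
    Real.cos (t * ∑ i ∈ B, X i ω); μ]) (cov[fun ω => Real.sin (t * ∑ i ∈ A, X i ω), fun ω =>
    Real.sin (t * ∑ i ∈ B, X i ω); μ]), abs_add_le (cov[fun ω => Real.sin (t * ∑ i ∈ A, X i ω),
    fun ω => Real.cos (t * ∑ i ∈ B, X i ω); μ]) (cov[fun ω => Real.cos (t * ∑ i ∈ A, X i ω),
    fun ω => Real.sin (t * ∑ i ∈ B, X i ω); μ])]

/-! ### Stationarity and growth of the variance -/

theorem IsStrictlyStationary.identDistrib_sum {Ω : Type*} [MeasurableSpace Ω] {X : ℕ → Ω → ℝ}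
    {μ : Measure Ω} (hX : IsStrictlyStationary X μ) (a n : ℕ) :
    IdentDistrib (fun ω => ∑ i ∈ range n, X (a + i) ω) (fun ω => ∑ i ∈ range n, X i ω) μ μ := by
  have h := (hX n (fun i => i) a).comp (u := fun x : Fin n → ℝ => ∑ i, x i) (by fun_prop)
  have e : ∀ (Y : ℕ → Ω → ℝ), (fun ω => ∑ i ∈ range n, Y i ω) = fun ω => ∑ i : Fin n, Y i ω :=
    fun Y => funext fun ω => (Fin.sum_univ_eq_sum_range (fun i => Y i ω) n).symm
  simp_rw [add_comm a]
  rw [e X, e fun i => X (i + a)]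
  exact h

theorem IsStrictlyStationary.identDistrib {Ω : Type*} [MeasurableSpace Ω] {X : ℕ → Ω → ℝ}
    {μ : Measure Ω} (hX : IsStrictlyStationary X μ) (i : ℕ) :
    IdentDistrib (X i) (X 0) μ μ := by
  simpa using hX.identDistrib_sum i 1

theorem IsStrictlyStationary.covariance_add_add {Ω : Type*} [MeasurableSpace Ω] {X : ℕ → Ω → ℝ}
    {μ : Measure Ω} (hX : IsStrictlyStationary X μ) (i j t : ℕ) :
    cov[X (i + t), X (j + t); μ] = cov[X i, X j; μ] := by
  have h := hX 2 ![i, j] t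
  have h1 := covariance_map_fun (X := fun x : Fin 2 → ℝ => x 0) (Y := fun x : Fin 2 → ℝ => x 1)
    (measurable_pi_apply 0).aestronglyMeasurable (measurable_pi_apply 1).aestronglyMeasurable
    h.aemeasurable_fst
  have h2 := covariance_map_fun (X := fun x : Fin 2 → ℝ => x 0) (Y := fun x : Fin 2 → ℝ => x 1)
    (measurable_pi_apply 0).aestronglyMeasurable (measurable_pi_apply 1).aestronglyMeasurable
    h.aemeasurable_snd
  rw [h.map_eq, h2] at h1
  exact h1.symm

theorem IsStrictlyStationary.variance_sum_range_succ {Ω : Type*} [MeasurableSpace Ω]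
    {X : ℕ → Ω → ℝ} {μ : Measure Ω} [IsProbabilityMeasure μ] (hX : IsStrictlyStationary X μ)
    (hL2 : ∀ i, MemLp (X i) 2 μ) (n : ℕ) :
    Var[fun ω => ∑ i ∈ range (n + 1), X i ω; μ] = Var[fun ω => ∑ i ∈ range n, X i ω; μ] +
      (Var[X 0; μ] + 2 * ∑ j ∈ range n, cov[X 0, X (j + 1); μ]) := by
  simp only [Finset.sum_range_succ _ n]
  rw [variance_fun_add (memLp_finsetSum _ fun i _ => hL2 i) (hL2 n),
    covariance_fun_sum_left' (fun i _ => hL2 i) (hL2 n), (hX.identDistrib n).variance_eq,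
    ← Finset.sum_range_reflect (fun i => cov[X i, X n; μ])]
  have : ∑ j ∈ range n, cov[X (n - 1 - j), X n; μ] = ∑ j ∈ range n, cov[X 0, X (j + 1); μ] := by
    refine Finset.sum_congr rfl fun j hj => ?_
    have hj := Finset.mem_range.1 hj
    have h := hX.covariance_add_add 0 (j + 1) (n - 1 - j)
    rwa [zero_add, show j + 1 + (n - 1 - j) = n by omega] at h
  rw [this]
  ring

/-- Successive increments of the variance are the partial sums defining `limitVariance`, so the
quotient is a Cesàro mean of a convergent sequence. -/
theorem IsStrictlyStationary.tendsto_variance_sum_div {Ω : Type*} [MeasurableSpace Ω]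
    {X : ℕ → Ω → ℝ} {μ : Measure Ω} [IsProbabilityMeasure μ] (hX : IsStrictlyStationary X μ)
    (hL2 : ∀ i, MemLp (X i) 2 μ) (hcov : Summable (fun j : ℕ => cov[X 0, X (j + 1); μ])) :
    Tendsto (fun n : ℕ => Var[fun ω => ∑ i ∈ range n, X i ω; μ] / n) atTop
      (nhds (limitVariance X μ)) := by
  have h := ((hcov.hasSum.tendsto_sum_nat.const_mul 2).const_add Var[X 0; μ]).cesaro
  refine h.congr fun n => ?_
  have : ∀ n, ∑ k ∈ range n, (Var[X 0; μ] + 2 * ∑ j ∈ range k, cov[X 0, X (j + 1); μ]) =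
      Var[fun ω => ∑ i ∈ range n, X i ω; μ] := by
    intro n
    induction n with
    | zero =>
      have : Var[fun _ => 0; μ] = 0 := variance_zero μ
      simp [this]
    | succ n ih => rw [Finset.sum_range_succ, ih, hX.variance_sum_range_succ hL2]
  rw [this, inv_mul_eq_div]

/-! ### Blocking and the incomplete block -/

/-- Approximate multiplicativity of the characteristic function of `X 0 + ⋯ + X (n - 1)`. -/
theorem IsAssociatedSeq.norm_charFun_sum_range_add_sub_mul_le {Ω : Type*} [MeasurableSpace Ω]
    {X : ℕ → Ω → ℝ} {μ : Measure Ω} [IsProbabilityMeasure μ] (hX : IsAssociatedSeq X μ)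
    (hstat : IsStrictlyStationary X μ) (hL2 : ∀ i, MemLp (X i) 2 μ) (a b : ℕ) (t : ℝ) :
    ‖charFun (μ.map fun ω => ∑ i ∈ range (a + b), X i ω) t -
      charFun (μ.map fun ω => ∑ i ∈ range a, X i ω) t *
        charFun (μ.map fun ω => ∑ i ∈ range b, X i ω) t‖ ≤
      2 * t ^ 2 * (Var[fun ω => ∑ i ∈ range (a + b), X i ω; μ] -
        Var[fun ω => ∑ i ∈ range a, X i ω; μ] - Var[fun ω => ∑ i ∈ range b, X i ω; μ]) := by
  have h := hX.norm_charFun_add_sub_mul_le hL2 (range a) ((range b).map (addLeftEmbedding a)) t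
  simp only [Finset.sum_map, addLeftEmbedding_apply] at h
  simp only [Finset.sum_range_add]
  rw [variance_fun_add (memLp_finsetSum _ fun i _ => hL2 i)
    (memLp_finsetSum _ fun i _ => hL2 (a + i)), ← (hstat.identDistrib_sum a b).variance_eq,
    ← (hstat.identDistrib_sum a b).map_eq]
  linarith

/-- Blocks are split off one at a time; the variance defects telescope, and earlier errors do not
grow because characteristic functions have norm at most one. -/
theorem IsAssociatedSeq.norm_charFun_sum_range_mul_sub_pow_le {Ω : Type*} [MeasurableSpace Ω]
    {X : ℕ → Ω → ℝ} {μ : Measure Ω} [IsProbabilityMeasure μ] (hX : IsAssociatedSeq X μ)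
    (hstat : IsStrictlyStationary X μ) (hL2 : ∀ i, MemLp (X i) 2 μ) (m l : ℕ) (t : ℝ) :
    ‖charFun (μ.map fun ω => ∑ i ∈ range (m * l), X i ω) t -
      charFun (μ.map fun ω => ∑ i ∈ range l, X i ω) t ^ m‖ ≤
      2 * t ^ 2 * (Var[fun ω => ∑ i ∈ range (m * l), X i ω; μ] -
        m * Var[fun ω => ∑ i ∈ range l, X i ω; μ]) := by
  induction m with
  | zero => simpa using (mul_nonneg (by positivity) (variance_nonneg _ _) :
      0 ≤ 2 * t ^ 2 * Var[fun _ : Ω => (0 : ℝ); μ])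
  | succ m ih =>
    have hm : ∀ n, AEMeasurable (fun ω => ∑ i ∈ range n, X i ω) μ :=
      fun n => (memLp_finsetSum _ fun i _ => hL2 i).1.aemeasurable
    have := Measure.isProbabilityMeasure_map (hm l)
    have h := hX.norm_charFun_sum_range_add_sub_mul_le hstat hL2 (m * l) l t
    rw [← Nat.succ_mul] at h
    set φ := charFun (μ.map fun ω => ∑ i ∈ range l, X i ω) t
    set ψ := charFun (μ.map fun ω => ∑ i ∈ range (m * l), X i ω) t
    have h1 : ‖(ψ - φ ^ m) * φ‖ ≤ ‖ψ - φ ^ m‖ := by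
      rw [norm_mul]
      exact mul_le_of_le_one_right (norm_nonneg _) (norm_charFun_le_one t)
    have h2 := norm_add_le (charFun (μ.map fun ω => ∑ i ∈ range ((m + 1) * l), X i ω) t - ψ * φ)
      ((ψ - φ ^ m) * φ)
    rw [show charFun (μ.map fun ω => ∑ i ∈ range ((m + 1) * l), X i ω) t - ψ * φ
      + (ψ - φ ^ m) * φ = charFun (μ.map fun ω => ∑ i ∈ range ((m + 1) * l), X i ω) t
        - φ ^ (m + 1) by ring] at h2
    push_cast
    simp only [Nat.succ_eq_add_one] at h
    linarith

theorem norm_charFun_map_sub_le {Ω : Type*} [MeasurableSpace Ω] {μ : Measure Ω}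
    [IsProbabilityMeasure μ] {U V : Ω → ℝ} (hU : AEMeasurable U μ) (hV : AEMeasurable V μ)
    (hUV : Integrable (fun ω => U ω - V ω) μ) (t : ℝ) :
    ‖charFun (μ.map U) t - charFun (μ.map V) t‖ ≤ |t| * ∫ ω, |U ω - V ω| ∂μ := by
  have he : ∀ W : Ω → ℝ, AEMeasurable W μ →
      Integrable (fun ω => Complex.exp (t * W ω * Complex.I)) μ := fun W hW =>
    Integrable.of_bound (by fun_prop) 1 (ae_of_all _ fun ω => by
      rw [← Complex.ofReal_mul, Complex.norm_exp_ofReal_mul_I])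
  rw [charFun_apply_real, charFun_apply_real, integral_map hU (by fun_prop),
    integral_map hV (by fun_prop), ← integral_sub (he U hU) (he V hV), ← integral_const_mul]
  refine norm_integral_le_of_norm_le (hUV.abs.const_mul _) (ae_of_all _ fun ω => ?_)
  have h : Complex.exp (t * U ω * Complex.I) - Complex.exp (t * V ω * Complex.I) =
      Complex.exp ((t * V ω : ℝ) * Complex.I) *
        (Complex.exp (Complex.I * (t * (U ω - V ω) : ℝ)) - 1) := by
    rw [mul_sub, ← Complex.exp_add, mul_one]
    push_cast
    ring_nf
  rw [h, norm_mul, Complex.norm_exp_ofReal_mul_I, one_mul, ← abs_mul]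
  exact Real.norm_exp_I_mul_ofReal_sub_one_le

theorem IsStrictlyStationary.norm_charFun_sum_range_add_sub_le {Ω : Type*} [MeasurableSpace Ω]
    {X : ℕ → Ω → ℝ} {μ : Measure Ω} [IsProbabilityMeasure μ] (hstat : IsStrictlyStationary X μ)
    (hint : ∀ i, Integrable (X i) μ) (k r : ℕ) (t : ℝ) :
    ‖charFun (μ.map fun ω => ∑ i ∈ range (k + r), X i ω) t -
      charFun (μ.map fun ω => ∑ i ∈ range k, X i ω) t‖ ≤ |t| * (r * ∫ ω, |X 0 ω| ∂μ) := by
  have hm : ∀ n, Integrable (fun ω => ∑ i ∈ range n, X i ω) μ :=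
    fun n => integrable_finsetSum _ fun i _ => hint i
  refine (norm_charFun_map_sub_le (hm _).1.aemeasurable (hm _).1.aemeasurable
    ((hm _).sub (hm _)) t).trans (mul_le_mul_of_nonneg_left ?_ (abs_nonneg t))
  have h : ∀ i, ∫ ω, |X i ω| ∂μ = ∫ ω, |X 0 ω| ∂μ := fun i => (hstat.identDistrib i).norm.integral_eq
  calc ∫ ω, |∑ i ∈ range (k + r), X i ω - ∑ i ∈ range k, X i ω| ∂μ
      ≤ ∫ ω, ∑ i ∈ range r, |X (k + i) ω| ∂μ := by
        refine integral_mono ((hm _).sub (hm _)).abs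
          (integrable_finsetSum _ fun i _ => (hint _).abs) fun ω => ?_
        simp only [Finset.sum_range_add, add_sub_cancel_left]
        exact Finset.abs_sum_le_sum_abs _ _
    _ = r * ∫ ω, |X 0 ω| ∂μ := by
        rw [integral_finsetSum _ fun i _ => (hint _).abs]
        simp [h]

theorem norm_pow_sub_pow_le_mul_norm_sub {R : Type*} [NormedCommRing R] [NormOneClass R] {z w : R}
    (hz : ‖z‖ ≤ 1) (hw : ‖w‖ ≤ 1) (k : ℕ) : ‖z ^ k - w ^ k‖ ≤ k * ‖z - w‖ := by
  induction k with
  | zero => simp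
  | succ k ih =>
    have h1 : ‖z ^ k * (z - w)‖ ≤ ‖z - w‖ := (norm_mul_le _ _).trans
      (mul_le_of_le_one_left (norm_nonneg _) ((norm_pow_le z k).trans (pow_le_one₀ (by simp) hz)))
    have h2 : ‖(z ^ k - w ^ k) * w‖ ≤ ‖z ^ k - w ^ k‖ :=
      (norm_mul_le _ _).trans (mul_le_of_le_one_right (norm_nonneg _) hw)
    have h3 := norm_add_le (z ^ k * (z - w)) ((z ^ k - w ^ k) * w)
    rw [show z ^ k * (z - w) + (z ^ k - w ^ k) * w = z ^ (k + 1) - w ^ (k + 1) by ring] at h3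
    push_cast
    linarith

/-! ### Central limit theorem for a fixed block law -/

theorem charFun_map_sub_isLittleO {Ω : Type*} [MeasurableSpace Ω] {μ : Measure Ω}
    [IsProbabilityMeasure μ] {U : Ω → ℝ} (hU : MemLp U 2 μ) (h0 : μ[U] = 0) :
    (fun t : ℝ => charFun (μ.map U) t - (1 - (Var[U; μ] : ℂ) * t ^ 2 / 2))
      =o[nhds 0] fun t : ℝ => t ^ 2 := by
  have hid : MemLp id 2 (μ.map U) := by
    rw [memLp_map_measure_iff (by fun_prop) hU.1.aemeasurable]
    exact hU
  have := Measure.isProbabilityMeasure_map hU.1.aemeasurable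
  have h := taylor_isLittleO_univ (x₀ := 0) (n := 2)
    (contDiff_charFun (μ := μ.map U) (n := 2) (by exact_mod_cast hid))
  simp_rw [taylorWithinEval_charFun_two_zero hU.1.aemeasurable hid, h0] at h
  rw [variance_of_integral_eq_zero hU.1.aemeasurable h0]
  simpa using h

/-- A centered law with finite variance has the same characteristic function as the Gaussian law
of the same variance, up to second order at `0`. -/
theorem charFun_sub_charFun_gaussianReal_isLittleO {Ω : Type*} [MeasurableSpace Ω]
    {μ : Measure Ω} [IsProbabilityMeasure μ] {U : Ω → ℝ} (hU : MemLp U 2 μ) (h0 : μ[U] = 0) :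
    (fun t => charFun (μ.map U) t - charFun (gaussianReal 0 Var[U; μ].toNNReal) t)
      =o[nhds 0] fun t : ℝ => t ^ 2 := by
  have hG := charFun_map_sub_isLittleO (μ := gaussianReal 0 Var[U; μ].toNNReal)
    (memLp_id_gaussianReal 2) (by simp)
  rw [Measure.map_id, variance_id_gaussianReal, Real.coe_toNNReal _ (variance_nonneg _ _)] at hG
  simpa using (charFun_map_sub_isLittleO hU h0).sub hG

theorem tendsto_inv_sqrt_mul_nhds_zero (t : ℝ) :
    Tendsto (fun n : ℕ => (√n)⁻¹ * t) atTop (nhds 0) := by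
  rw [← zero_mul t]
  exact .mul_const t (tendsto_inv_atTop_zero.comp <| Real.tendsto_sqrt_atTop.comp
    tendsto_natCast_atTop_atTop)

theorem inv_sqrt_mul_sq (n : ℕ) (t : ℝ) : ((√n)⁻¹ * t) ^ 2 = t ^ 2 / n := by
  rw [mul_pow, inv_pow, Real.sq_sqrt (Nat.cast_nonneg n)]
  ring

/-- Against the Gaussian of equal variance, whose powers are explicit, the error is at most `n`
times an `o(1 / n)`. -/
theorem tendsto_charFun_inv_sqrt_mul_pow_of_tendsto_div {Ω : Type*} [MeasurableSpace Ω]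
    {μ : Measure Ω} [IsProbabilityMeasure μ] {U : Ω → ℝ} (hU : MemLp U 2 μ) (h0 : μ[U] = 0)
    {k : ℕ → ℕ} (hk : ∀ n, k n ≤ n) {a : ℝ}
    (hka : Tendsto (fun n => (k n : ℝ) / n) atTop (nhds a)) (t : ℝ) :
    Tendsto (fun n : ℕ => charFun (μ.map U) ((√n)⁻¹ * t) ^ k n) atTop
      (nhds (Complex.exp ((-(Var[U; μ] * t ^ 2 / 2 * a) : ℝ) : ℂ))) := by
  have := Measure.isProbabilityMeasure_map hU.1.aemeasurable
  set γ := gaussianReal 0 Var[U; μ].toNNReal with hγ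
  have hγk : ∀ n : ℕ, charFun γ ((√n)⁻¹ * t) ^ k n =
      Complex.exp ((-(Var[U; μ] * t ^ 2 / 2 * (k n / n)) : ℝ) : ℂ) := by
    intro n
    rw [hγ, charFun_gaussianReal, ← Complex.exp_nat_mul,
      Real.coe_toNNReal _ (variance_nonneg _ _), ← Complex.ofReal_pow, inv_sqrt_mul_sq]
    push_cast
    ring_nf
  have hlim : Tendsto (fun n : ℕ => charFun γ ((√n)⁻¹ * t) ^ k n) atTop
      (nhds (Complex.exp ((-(Var[U; μ] * t ^ 2 / 2 * a) : ℝ) : ℂ))) := by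
    simp_rw [hγk]
    exact ((Complex.continuous_exp.comp Complex.continuous_ofReal).tendsto _).comp
      (hka.const_mul _).neg
  have hsmall : Tendsto (fun n : ℕ => (n : ℝ) *
      ‖charFun (μ.map U) ((√n)⁻¹ * t) - charFun γ ((√n)⁻¹ * t)‖) atTop (nhds 0) := by
    have h := ((charFun_sub_charFun_gaussianReal_isLittleO hU h0).comp_tendsto
      (tendsto_inv_sqrt_mul_nhds_zero t)).norm_left
    have h1 : (fun n : ℕ => ((√n)⁻¹ * t) ^ 2) =O[atTop] fun n : ℕ => (n : ℝ)⁻¹ := by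
      simp_rw [inv_sqrt_mul_sq, div_eq_mul_inv]
      exact (Asymptotics.isBigO_refl _ _).const_mul_left _
    refine (h.trans_isBigO h1).tendsto_div_nhds_zero.congr fun n => ?_
    simp [hγ, mul_comm]
  have hdiff : Tendsto (fun n : ℕ => charFun (μ.map U) ((√n)⁻¹ * t) ^ k n -
      charFun γ ((√n)⁻¹ * t) ^ k n) atTop (nhds 0) := by
    refine squeeze_zero_norm (fun n => ?_) hsmall
    refine (norm_pow_sub_pow_le_mul_norm_sub (norm_charFun_le_one _) (norm_charFun_le_one _)
      _).trans (mul_le_mul_of_nonneg_right ?_ (norm_nonneg _))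
    exact_mod_cast hk n
  simpa using hdiff.add hlim

/-! ### Iterated limit and conclusion -/

theorem tendsto_natCast_div_div_atTop (l : ℕ) :
    Tendsto (fun n : ℕ => ((n / l : ℕ) : ℝ) / n) atTop (nhds (l : ℝ)⁻¹) := by
  have h := (tendsto_nat_floor_mul_div_atTop (R := ℝ) (a := (l : ℝ)⁻¹) (by positivity)).comp
    tendsto_natCast_atTop_atTop
  refine h.congr fun n => ?_
  simp only [Function.comp_apply]
  rw [inv_mul_eq_div, Nat.floor_div_eq_div]

theorem Filter.tendsto_of_dist_le_of_tendsto {E : Type*} [PseudoMetricSpace E] {f : ℕ → E} {L : E}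
    {B : ℕ → ℕ → ℝ} {b : ℕ → ℝ} (hB : ∀ᶠ l in atTop, ∀ n, dist (f n) L ≤ B l n)
    (hBb : ∀ᶠ l in atTop, Tendsto (B l) atTop (nhds (b l))) (hb : Tendsto b atTop (nhds 0)) :
    Tendsto f atTop (nhds L) := by
  rw [Metric.tendsto_nhds]
  intro ε hε
  obtain ⟨l, h1, h2, h3⟩ := (hB.and (hBb.and (hb.eventually_lt_const hε))).exists
  filter_upwards [h2.eventually_lt_const h3] with n hn using (h1 n).trans_lt hn

theorem IsAssociatedSeq.tendsto_charFun_sum_range {Ω : Type*} [MeasurableSpace Ω]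
    {X : ℕ → Ω → ℝ} {μ : Measure Ω} [IsProbabilityMeasure μ] (hX : IsAssociatedSeq X μ)
    (hstat : IsStrictlyStationary X μ) (hL2 : ∀ i, MemLp (X i) 2 μ) (h0 : ∀ i, ∫ ω, X i ω ∂μ = 0)
    (hcov : Summable (fun j : ℕ => cov[X 0, X (j + 1); μ])) (t : ℝ) :
    Tendsto (fun n : ℕ => charFun (μ.map fun ω => ∑ i ∈ range n, X i ω) ((√n)⁻¹ * t)) atTop
      (nhds (Complex.exp ((-(limitVariance X μ * t ^ 2 / 2) : ℝ) : ℂ))) := by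
  set V : ℕ → ℝ := fun n => Var[fun ω => ∑ i ∈ range n, X i ω; μ] with hV
  set φ : ℕ → ℝ → ℂ := fun n => charFun (μ.map fun ω => ∑ i ∈ range n, X i ω) with hφ
  set σ := limitVariance X μ
  have hVσ : Tendsto (fun n : ℕ => V n / n) atTop (nhds σ) := hstat.tendsto_variance_sum_div hL2 hcov
  have hint : ∀ i, Integrable (X i) μ := fun i => (hL2 i).integrable one_le_two
  let G : ℝ → ℂ := fun v => Complex.exp ((-(v * t ^ 2 / 2) : ℝ) : ℂ)
  have hG : Continuous G := by fun_prop
  -- The four errors are the dropped incomplete block, the blocking, the block limit theorem, and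
  -- the replacement of `V l / l` by `σ`, which here denotes the limiting variance.
  refine Filter.tendsto_of_dist_le_of_tendsto
    (B := fun l n => |(√n)⁻¹ * t| * (l * ∫ ω, |X 0 ω| ∂μ) +
      2 * ((√n)⁻¹ * t) ^ 2 * (V (n / l * l) - (n / l : ℕ) * V l) +
      dist (φ l ((√n)⁻¹ * t) ^ (n / l)) (G (V l / l)) + dist (G (V l / l)) (G σ))
    (b := fun l => |0| * (l * ∫ ω, |X 0 ω| ∂μ) + 2 * t ^ 2 * (σ - V l / l) + 0 +
      dist (G (V l / l)) (G σ)) ?_ ?_ ?_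
  · filter_upwards [eventually_gt_atTop 0] with l hl n
    set s := (√n)⁻¹ * t
    have h1 : dist (φ n s) (φ (n / l * l) s) ≤ |s| * (l * ∫ ω, |X 0 ω| ∂μ) := by
      have h := hstat.norm_charFun_sum_range_add_sub_le hint (n / l * l) (n % l) s
      rw [mul_comm (n / l) l, Nat.div_add_mod, mul_comm l] at h
      rw [dist_eq_norm]
      refine h.trans ?_
      gcongr
      exact (Nat.mod_lt n hl).le
    have h2 : dist (φ (n / l * l) s) (φ l s ^ (n / l)) ≤
        2 * s ^ 2 * (V (n / l * l) - (n / l : ℕ) * V l) := by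
      rw [dist_eq_norm]
      exact hX.norm_charFun_sum_range_mul_sub_pow_le hstat hL2 (n / l) l s
    have h3 := dist_triangle4 (φ n s) (φ (n / l * l) s) (φ l s ^ (n / l)) (G (V l / l))
    have h4 := dist_triangle (φ n s) (G (V l / l)) (G σ)
    change dist (φ n s) (G σ) ≤ _
    linarith
  · filter_upwards [eventually_gt_atTop 0] with l hl
    have hl' : (l : ℝ) ≠ 0 := by positivity
    refine (((tendsto_inv_sqrt_mul_nhds_zero t).abs.mul_const _).add ?_).add ?_ |>.add_const _
    · have hm := tendsto_natCast_div_div_atTop l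
      have hml : Tendsto (fun n : ℕ => n / l * l) atTop atTop :=
        (Nat.tendsto_div_const_atTop hl.ne').atTop_mul_const' hl
      have h1 := ((hVσ.comp hml).mul (hm.mul_const (l : ℝ))).sub (hm.mul_const (V l))
      rw [inv_mul_cancel₀ hl', mul_one, inv_mul_eq_div] at h1
      refine (h1.const_mul (2 * t ^ 2)).congr' ?_
      -- There must be at least one full block to cancel `n / l` in `V (n / l * l) / (n / l * l) *
      -- ((n / l) / n * l)`.
      filter_upwards [eventually_ge_atTop l] with n hn
      have hnl : ((n / l : ℕ) : ℝ) ≠ 0 := by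
        exact_mod_cast (Nat.div_pos hn hl).ne'
      simp only [Function.comp_apply]
      rw [inv_sqrt_mul_sq]
      push_cast
      field_simp
    · rw [← dist_self (G (V l / l))]
      refine Tendsto.dist ?_ tendsto_const_nhds
      have h := tendsto_charFun_inv_sqrt_mul_pow_of_tendsto_div
        (memLp_finsetSum (range l) fun i _ => hL2 i)
        (by rw [integral_finsetSum _ fun i _ => hint i]; simp [h0])
        (fun n => Nat.div_le_self n l) (tendsto_natCast_div_div_atTop l) t
      have e : V l * t ^ 2 / 2 * (l : ℝ)⁻¹ = V l / l * t ^ 2 / 2 := by ring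
      rwa [e] at h
  · have h1 := (hVσ.const_sub σ).const_mul (2 * t ^ 2)
    have h2 := ((hG.tendsto σ).comp hVσ).dist (tendsto_const_nhds (x := G σ))
    simpa using h1.add h2

theorem mainTheorem1 {Ω : Type*} [MeasurableSpace Ω] (μ : Measure Ω) [IsProbabilityMeasure μ]
    (X : ℕ → Ω → ℝ) (hmeas : ∀ i, AEMeasurable (X i) μ)
    (hstat : IsStrictlyStationary X μ)
    (hmean : ∀ i, Integrable (X i) μ ∧ ∫ ω, X i ω ∂μ = 0)
    (hassoc : IsAssociatedSeq X μ)
    (hvar : MemLp (X 0) 2 μ)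
    (hcov : Summable (fun j : ℕ => cov[X 0, X (j + 1); μ])) :
    0 ≤ limitVariance X μ ∧
      TendstoInDistribution
        (fun (n : ℕ) (ω : Ω) => (∑ i ∈ Finset.range n, X i ω) / Real.sqrt (n : ℝ)) atTop
        (id : ℝ → ℝ) (fun _ => μ) (gaussianReal 0 (limitVariance X μ).toNNReal) := by
  have hL2 : ∀ i, MemLp (X i) 2 μ := fun i => (hstat.identDistrib i).memLp_iff.2 hvar
  have hσ : 0 ≤ limitVariance X μ :=
    ge_of_tendsto' (hstat.tendsto_variance_sum_div hL2 hcov) fun n =>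
      div_nonneg (variance_nonneg _ _) n.cast_nonneg
  have hS : ∀ n, AEMeasurable (fun ω => ∑ i ∈ range n, X i ω) μ :=
    fun n => Finset.aemeasurable_fun_sum _ fun i _ => hmeas i
  refine ⟨hσ, ⟨fun n => (hS n).div_const _, aemeasurable_id, ?_⟩⟩
  -- The Gaussian formula also covers zero variance, so the degenerate case needs no separate
  -- treatment.
  refine ProbabilityMeasure.tendsto_iff_tendsto_charFun.2 fun t => ?_
  have h := hassoc.tendsto_charFun_sum_range hstat hL2 (fun i => (hmean i).2) hcov t
  simp only [ProbabilityMeasure.coe_mk, Measure.map_id, charFun_gaussianReal,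
    Real.coe_toNNReal _ hσ]
  convert! h using 2 with n
  · simp_rw [div_eq_inv_mul]
    exact charFun_map_mul_comp (hS n) _ _
  · push_cast
    simp
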